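/- Let $E$ be a (real) Banach lattice with dual Banach lattice $E'$, and let $A\subseteq E$ be a norm bounded set. Write $\mathrm{Sol}(A)=\{y\in E: |y|\le |x| \text{ for some } x\in A\}$ for the solid hull of $A$. A sequence $(x_n)$ in a Banach lattice is disjoint if $|x_m|\wedge|x_n|=0$ for all $m\neq n$, and order bounded if it is contained in some order interval $[a,b]$. A norm bounded set $A\subseteq E$ is called disjointly weakly compact if every disjoint sequence in $\mathrm{Sol}(A)$ is weakly null. A sequence $(f_n)$ in $E'$ converges uniformly to zero on $A$ if $\sup_{x\in A}|f_n(x)|\to 0$. A sequence $(f_n)$ in $E'$ is called an $L$-sequence if the set $B=\{f_n:n\in\mathbb N\}$ is norm bounded and $\sup_{f\in B}|f(x_k)|\to 0$ as $k\to\infty$ for every weakly null sequence $(x_k)$ in $E$. **Theorem.** The following statements are equivalent. 1. $A$ is disjointly weakly compact. 2. Every order bounded sequence $(f_n)$ in $(E')^+=\{f\in E' : f\ge 0\}$ with $f_n\to 0$ in the weak$^*$ topology converges uniformly to zero on $A$. 3. Every disjoint $L$-sequence $(f_n)$ in $E'$ converges uniformly to zero on $A$. 4. Every order bounded disjoint sequence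 $(f_n)$ in $E'$ converges uniformly to zero on $A$. -/

import Mathlib

open Filter Topology

namespace BanachLattice

set_option linter.unusedSectionVars false

section DualLattice

variable {E : Type*} [NormedAddCommGroup E] [NormedSpace ℝ E] [Lattice E] [HasSolidNorm E]
  [IsOrderedAddMonoid E]

/-- The dual order on `E′`: `f ≤ g` iff `f x ≤ g x` for every `x` in the positive cone of `E`. -/
instance dualPartialOrder : PartialOrder (StrongDual ℝ E) where
  le f g := ∀ x : E, 0 ≤ x → f x ≤ g x
  le_refl _ _ _ := le_rfl
  le_trans _ _ _ hfg hgh x hx := (hfg x hx).trans (hgh x hx)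
  le_antisymm f g hfg hgf := by
    ext x
    have h : ∀ y : E, 0 ≤ y → f y = g y := fun y hy => le_antisymm (hfg y hy) (hgf y hy)
    rw [← posPart_sub_negPart x, map_sub, map_sub, h _ (posPart_nonneg x), h _ (negPart_nonneg x)]

theorem dual_le_iff {f g : StrongDual ℝ E} : f ≤ g ↔ ∀ x : E, 0 ≤ x → f x ≤ g x := Iff.rfl

/-- The Riesz–Kantorovich formula for `f⁺` on the positive cone: the supremum of `f` on the
order interval `[0, x]`. -/
noncomputable def rkSup (f : StrongDual ℝ E) (x : E) : ℝ := sSup (f '' Set.Icc 0 x)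

theorem norm_le_of_mem_Icc {x y : E} (hy : y ∈ Set.Icc 0 x) : ‖y‖ ≤ ‖x‖ := by
  apply norm_le_norm_of_abs_le_abs
  rw [abs_of_nonneg hy.1, abs_of_nonneg (hy.1.trans hy.2)]
  exact hy.2

theorem apply_le_of_mem_Icc (f : StrongDual ℝ E) {x y : E} (hy : y ∈ Set.Icc 0 x) :
    f y ≤ ‖f‖ * ‖x‖ :=
  (le_abs_self _).trans ((f.le_opNorm y).trans
    (mul_le_mul_of_nonneg_left (norm_le_of_mem_Icc hy) (norm_nonneg f)))

theorem rkSup_le (f : StrongDual ℝ E) {x : E} (hx : 0 ≤ x) {c : ℝ}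
    (h : ∀ y ∈ Set.Icc 0 x, f y ≤ c) : rkSup f x ≤ c := by
  refine csSup_le ⟨f 0, 0, ⟨le_rfl, hx⟩, rfl⟩ ?_
  rintro _ ⟨y, hy, rfl⟩
  exact h y hy

theorem le_rkSup (f : StrongDual ℝ E) {x y : E} (hy : y ∈ Set.Icc 0 x) : f y ≤ rkSup f x := by
  refine le_csSup ⟨‖f‖ * ‖x‖, ?_⟩ ⟨y, hy, rfl⟩
  rintro _ ⟨z, hz, rfl⟩
  exact apply_le_of_mem_Icc f hz

theorem rkSup_nonneg (f : StrongDual ℝ E) {x : E} (hx : 0 ≤ x) : 0 ≤ rkSup f x := by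
  simpa using le_rkSup f (x := x) (y := 0) ⟨le_rfl, hx⟩

theorem rkSup_add (f : StrongDual ℝ E) {x y : E} (hx : 0 ≤ x) (hy : 0 ≤ y) :
    rkSup f (x + y) = rkSup f x + rkSup f y := by
  apply le_antisymm
  · refine rkSup_le f (add_nonneg hx hy) fun z hz => ?_
    have h1 : f (z ⊓ x) ≤ rkSup f x := le_rkSup f ⟨le_inf hz.1 hx, inf_le_right⟩
    have h2 : f (z - z ⊓ x) ≤ rkSup f y := by
      refine le_rkSup f ⟨sub_nonneg.2 inf_le_left, ?_⟩
      rw [sub_le_comm]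
      refine le_inf (sub_le_self _ hy) ?_
      rw [sub_le_iff_le_add]
      exact hz.2
    have h3 : f z = f (z ⊓ x) + f (z - z ⊓ x) := by rw [← map_add, add_sub_cancel]
    linarith
  · rw [← le_sub_iff_add_le]
    refine rkSup_le f hx fun u hu => ?_
    rw [le_sub_comm]
    refine rkSup_le f hy fun v hv => ?_
    have h := le_rkSup f (x := x + y) (y := u + v)
      ⟨add_nonneg hu.1 hv.1, add_le_add hu.2 hv.2⟩
    rw [map_add] at h
    linarith

theorem rkSup_sub_eq (f : StrongDual ℝ E) {a b c d : E} (ha : 0 ≤ a) (hb : 0 ≤ b) (hc : 0 ≤ c)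
    (hd : 0 ≤ d) (h : a - b = c - d) : rkSup f a - rkSup f b = rkSup f c - rkSup f d := by
  have h1 : a + d = c + b := by
    rw [sub_eq_sub_iff_add_eq_add] at h
    exact h
  have h2 := congrArg (rkSup f) h1
  rw [rkSup_add f ha hd, rkSup_add f hc hb] at h2
  linarith

/-- The additive extension of the Riesz–Kantorovich supremum from the positive cone to `E`. -/
noncomputable def dualPosPartHom (f : StrongDual ℝ E) : E →+ ℝ :=
  AddMonoidHom.mk' (fun x => rkSup f x⁺ - rkSup f x⁻) fun x y => by
    have h := rkSup_sub_eq f (posPart_nonneg (x + y)) (negPart_nonneg (x + y))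
      (add_nonneg (posPart_nonneg x) (posPart_nonneg y))
      (add_nonneg (negPart_nonneg x) (negPart_nonneg y))
      (by rw [add_sub_add_comm, posPart_sub_negPart, posPart_sub_negPart, posPart_sub_negPart])
    rw [rkSup_add f (posPart_nonneg x) (posPart_nonneg y),
      rkSup_add f (negPart_nonneg x) (negPart_nonneg y)] at h
    rw [h]
    ring

theorem dualPosPartHom_bound (f : StrongDual ℝ E) (x : E) :
    ‖dualPosPartHom f x‖ ≤ ‖f‖ * ‖x‖ := by
  have key : ∀ y : E, 0 ≤ y → y ≤ |x| → 0 ≤ rkSup f y ∧ rkSup f y ≤ ‖f‖ * ‖x‖ := by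
    intro y hy hyx
    refine ⟨rkSup_nonneg f hy, (rkSup_le f hy fun z hz => apply_le_of_mem_Icc f hz).trans ?_⟩
    refine mul_le_mul_of_nonneg_left (norm_le_norm_of_abs_le_abs ?_) (norm_nonneg f)
    rwa [abs_of_nonneg hy]
  have h1 := key x⁺ (posPart_nonneg x) (sup_le (le_abs_self x) (abs_nonneg x))
  have h2 := key x⁻ (negPart_nonneg x) (sup_le (neg_le_abs x) (abs_nonneg x))
  change |rkSup f x⁺ - rkSup f x⁻| ≤ _
  rw [abs_le]
  constructor <;> linarith [h1.1, h1.2, h2.1, h2.2]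

/-- The positive part of a continuous functional, as a continuous functional. -/
noncomputable def dualPosPart (f : StrongDual ℝ E) : StrongDual ℝ E :=
  (dualPosPartHom f).toRealLinearMap
    (AddMonoidHomClass.continuous_of_bound (dualPosPartHom f) ‖f‖ (dualPosPartHom_bound f))

theorem dualPosPart_apply (f : StrongDual ℝ E) {x : E} (hx : 0 ≤ x) :
    dualPosPart f x = rkSup f x := by
  have h0 : rkSup f 0 = 0 :=
    le_antisymm (rkSup_le f le_rfl fun y hy => by simp [le_antisymm hy.2 hy.1])
      (rkSup_nonneg f le_rfl)
  change rkSup f x⁺ - rkSup f x⁻ = rkSup f x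
  rw [posPart_of_nonneg hx, negPart_of_nonneg hx, h0, sub_zero]

/-- The dual of a normed lattice is a lattice for the dual order. -/
noncomputable instance dualLattice : Lattice (StrongDual ℝ E) where
  sup f g := g + dualPosPart (f - g)
  le_sup_left f g x hx := by
    have h := le_rkSup (f - g) (x := x) (y := x) ⟨hx, le_rfl⟩
    rw [add_apply, dualPosPart_apply _ hx]
    rw [sub_apply] at h
    linarith
  le_sup_right f g x hx := by
    have h := rkSup_nonneg (f - g) hx
    rw [add_apply, dualPosPart_apply _ hx]
    linarith
  sup_le f g h hf hg x hx := by
    rw [add_apply, dualPosPart_apply _ hx]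
    have key : rkSup (f - g) x ≤ h x - g x := by
      refine rkSup_le _ hx fun y hy => ?_
      have h1 := hf y hy.1
      have h2 := hg (x - y) (sub_nonneg.2 hy.2)
      rw [map_sub, map_sub] at h2
      rw [sub_apply]
      linarith
    linarith
  inf f g := f - dualPosPart (f - g)
  inf_le_left f g x hx := by
    have h := rkSup_nonneg (f - g) hx
    rw [sub_apply, dualPosPart_apply _ hx]
    linarith
  inf_le_right f g x hx := by
    have h := le_rkSup (f - g) (x := x) (y := x) ⟨hx, le_rfl⟩
    rw [sub_apply, dualPosPart_apply _ hx]
    rw [sub_apply] at h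
    linarith
  le_inf h f g hf hg x hx := by
    rw [sub_apply, dualPosPart_apply _ hx]
    have key : rkSup (f - g) x ≤ f x - h x := by
      refine rkSup_le _ hx fun y hy => ?_
      have h1 := hg y hy.1
      have h2 := hf (x - y) (sub_nonneg.2 hy.2)
      rw [map_sub, map_sub] at h2
      rw [sub_apply]
      linarith
    linarith

instance dualIsOrderedAddMonoid : IsOrderedAddMonoid (StrongDual ℝ E) where
  add_le_add_left _ _ hfg h x hx := by
    simpa using hfg x hx

end DualLattice

/-- A sequence in a vector lattice whose terms are pairwise disjoint, `|x m| ∧ |x n| = 0`. -/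
def DisjointSeq {G : Type*} [AddCommGroup G] [Lattice G] (x : ℕ → G) : Prop :=
  Pairwise fun m n => |x m| ⊓ |x n| = 0

/-- A sequence contained in some order interval. -/
def OrderBoundedSeq {G : Type*} [Preorder G] (x : ℕ → G) : Prop :=
  ∃ a b : G, ∀ n, x n ∈ Set.Icc a b

/-- Convergence to `0` in the weak topology. -/
def WeaklyNull {X : Type*} [NormedAddCommGroup X] [NormedSpace ℝ X] (x : ℕ → X) : Prop :=
  Tendsto (fun n => toWeakSpace ℝ X (x n)) atTop (𝓝 0)

/-- Convergence to `0` in the weak* topology of the dual. -/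
def WeakStarNull {X : Type*} [NormedAddCommGroup X] [NormedSpace ℝ X]
    (f : ℕ → StrongDual ℝ X) : Prop :=
  Tendsto (fun n => StrongDual.toWeakDual (f n)) atTop (𝓝 0)

/-- A sequence of functionals converging to zero uniformly on `A`. -/
def UniformlyNullOn {X : Type*} [NormedAddCommGroup X] [NormedSpace ℝ X]
    (f : ℕ → StrongDual ℝ X) (A : Set X) : Prop :=
  TendstoUniformlyOn (fun n x => f n x) (fun _ => 0) atTop A

/-- A bounded set of functionals on which every weakly null sequence converges uniformly to zero. -/
def IsLSet {X : Type*} [NormedAddCommGroup X] [NormedSpace ℝ X] (B : Set (StrongDual ℝ X)) :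
    Prop :=
  Bornology.IsBounded B ∧ ∀ x : ℕ → X, WeaklyNull x →
    TendstoUniformlyOn (fun n (f : StrongDual ℝ X) => f (x n)) (fun _ => 0) atTop B

def IsLSequence {X : Type*} [NormedAddCommGroup X] [NormedSpace ℝ X]
    (f : ℕ → StrongDual ℝ X) : Prop :=
  IsLSet (Set.range f)

/-- A bounded set in whose solid hull every disjoint sequence is weakly null. -/
def IsDisjointlyWeaklyCompact {E : Type*} [NormedAddCommGroup E] [NormedSpace ℝ E] [Lattice E]
    (A : Set E) : Prop :=
  Bornology.IsBounded A ∧ ∀ x : ℕ → E, DisjointSeq x →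
    (∀ n, x n ∈ LatticeOrderedAddCommGroup.solidClosure A) → WeaklyNull x

end BanachLattice

open BanachLattice

/-! The implications run 1 → 2 → 4 → 1 and 1 → 3 → 4. From 1, disjointification
(`exists_forall_apply_posPart_sub_le`) makes `A` almost order bounded: some `u ≥ 0` makes `F (|x| -
u)⁺` small for all `x ∈ A` and all `F` in a suitable family. Since `|f x| ≤ |f| (|x| - u)⁺ + |f| u`,
only `|f n| u → 0` remains. In 2 this is weak* convergence, the family being a single order bound.
In 3 the family is all `|f n|`, and `tendsto_apply_of_pairwise_disjoint` supplies the limit. For 2 →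
4, sums of disjoint functionals below `g` stay below `g`, so `∑ |f n| x` converges for `x ≥ 0` and
both `(f n)⁺` and `(f n)⁻` are weak* null. For 3 → 4, order bounded disjoint sequences are
L-sequences: every subseries defines a functional, and Baire's theorem on the space of subseries
gives uniformity. For 4 → 1, a functional `g ≥ 0` is cut into disjoint components `p n` carried by
the disjoint `x n`, so that 4 controls `g |x n| = p n |x n|`. -/

namespace BanachLattice

set_option linter.unusedSectionVars false

/-! ### Disjointness in lattice-ordered groups -/

section LatticeGroup

variable {G : Type*} [AddCommGroup G] [Lattice G] [IsOrderedAddMonoid G]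

theorem inf_add_le_inf_add_inf {a b c : G} (ha : 0 ≤ a) (hb : 0 ≤ b) (hc : 0 ≤ c) :
    c ⊓ (a + b) ≤ c ⊓ a + c ⊓ b := by
  rw [add_inf, inf_add, inf_add]
  refine le_inf (le_inf ?_ ?_) (le_inf ?_ inf_le_right)
  · exact inf_le_left.trans (le_add_of_nonneg_right hc)
  · exact inf_le_left.trans (le_add_of_nonneg_left ha)
  · exact inf_le_left.trans (le_add_of_nonneg_right hb)

theorem inf_eq_zero_of_le {a b c d : G} (ha : 0 ≤ a) (hab : a ≤ b) (hc : 0 ≤ c) (hcd : c ≤ d)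
    (h : b ⊓ d = 0) : a ⊓ c = 0 :=
  le_antisymm ((inf_le_inf hab hcd).trans h.le) (le_inf ha hc)

theorem add_le_of_inf_eq_zero {a b g : G} (h : a ⊓ b = 0) (ha : a ≤ g) (hb : b ≤ g) :
    a + b ≤ g := by
  rw [← inf_add_sup, h, zero_add]
  exact sup_le ha hb

theorem inf_sum_eq_zero {F : ℕ → G} (h0 : ∀ n, 0 ≤ F n)
    (hd : Pairwise fun m n => F m ⊓ F n = 0) {s : Finset ℕ} {n : ℕ} (hn : n ∉ s) :
    F n ⊓ ∑ i ∈ s, F i = 0 := by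
  induction s using Finset.induction_on with
  | empty => simpa using h0 n
  | insert a s has ih =>
    rw [Finset.mem_insert, not_or] at hn
    rw [Finset.sum_insert has]
    have hs : 0 ≤ ∑ i ∈ s, F i := Finset.sum_nonneg fun i _ => h0 i
    refine le_antisymm ((inf_add_le_inf_add_inf (h0 a) hs (h0 n)).trans ?_)
      (le_inf (h0 n) (add_nonneg (h0 a) hs))
    rw [hd hn.1, ih hn.2, add_zero]

theorem sum_le_of_pairwise_inf_eq_zero {F : ℕ → G} {g : G} (h0 : ∀ n, 0 ≤ F n)
    (hd : Pairwise fun m n => F m ⊓ F n = 0) (hg : ∀ n, F n ≤ g) (s : Finset ℕ) :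
    ∑ i ∈ s, F i ≤ g := by
  induction s using Finset.induction_on with
  | empty => simpa using (h0 0).trans (hg 0)
  | insert a s has ih =>
    rw [Finset.sum_insert has]
    exact add_le_of_inf_eq_zero (inf_sum_eq_zero h0 hd has) (hg a) ih

theorem partialSups_le_sum {v : ℕ → G} (hv : ∀ n, 0 ≤ v n) (n : ℕ) :
    partialSups v n ≤ ∑ i ∈ Finset.range (n + 1), v i := by
  refine partialSups_le v n _ fun i hi => ?_
  exact Finset.single_le_sum (f := v) (fun j _ => hv j)
    (Finset.mem_range.2 (Nat.lt_succ_of_le hi))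

theorem posPart_le_posPart_sub_add {a b : G} (hb : 0 ≤ b) : a⁺ ≤ (a - b)⁺ + b := by
  refine sup_le ?_ (add_nonneg (posPart_nonneg _) hb)
  rw [← sub_le_iff_le_add]
  exact le_posPart _

theorem posPart_le_self_of_le {a b : G} (hb : 0 ≤ b) (h : a ≤ b) : a⁺ ≤ b := sup_le h hb

theorem posPart_le_abs' (a : G) : a⁺ ≤ |a| := sup_le (le_abs_self a) (abs_nonneg a)

theorem negPart_le_abs' (a : G) : a⁻ ≤ |a| := sup_le (neg_le_abs a) (abs_nonneg a)

theorem inf_eq_zero_of_smul [Module ℝ G] [IsOrderedModule ℝ G] {a b : G} {c : ℝ} (hc : 0 < c)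
    (ha : 0 ≤ a) (hb : 0 ≤ b) (h : a ⊓ (c • b) = 0) : a ⊓ b = 0 := by
  have ht : 0 ≤ a ⊓ b := le_inf ha hb
  have hm : 0 < min 1 c := lt_min one_pos hc
  have h1 : min 1 c • (a ⊓ b) ≤ 0 := by
    rw [← h]
    refine le_inf ?_ ?_
    · calc min 1 c • (a ⊓ b) ≤ (1 : ℝ) • (a ⊓ b) := smul_le_smul_of_nonneg_right (min_le_left _ _) ht
        _ ≤ a := by rw [one_smul]; exact inf_le_left
    · calc min 1 c • (a ⊓ b) ≤ c • (a ⊓ b) := smul_le_smul_of_nonneg_right (min_le_right _ _) ht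
        _ ≤ c • b := smul_le_smul_of_nonneg_left inf_le_right hc.le
  have h2 := smul_nonpos_of_nonneg_of_nonpos (inv_nonneg.2 hm.le) h1
  rw [smul_smul, inv_mul_cancel₀ hm.ne', one_smul] at h2
  exact le_antisymm h2 ht

/-- Up to the factor `c`, the second term is the negative part of `x - c • y`, hence disjoint from
its positive part. -/
theorem posPart_sub_smul_inf_posPart_sub_smul [Module ℝ G] [IsOrderedModule ℝ G] (x y : G) {c : ℝ}
    (hc : 0 < c) : (x - c • y)⁺ ⊓ (y - c⁻¹ • x)⁺ = 0 := by
  refine inf_eq_zero_of_smul hc (posPart_nonneg _) (posPart_nonneg _) ?_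
  have h : c • (y - c⁻¹ • x)⁺ ≤ (x - c • y)⁻ := by
    have h1 : (y - c⁻¹ • x)⁺ ≤ c⁻¹ • (x - c • y)⁻ := by
      refine posPart_le_self_of_le (smul_nonneg (inv_nonneg.2 hc.le) (negPart_nonneg _)) ?_
      calc y - c⁻¹ • x = c⁻¹ • (-(x - c • y)) := by
            rw [neg_sub, smul_sub, smul_smul, inv_mul_cancel₀ hc.ne', one_smul]
        _ ≤ _ := smul_le_smul_of_nonneg_left (neg_le_negPart _) (inv_nonneg.2 hc.le)
    calc c • (y - c⁻¹ • x)⁺ ≤ c • c⁻¹ • (x - c • y)⁻ := smul_le_smul_of_nonneg_left h1 hc.le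
      _ = _ := by rw [smul_smul, mul_inv_cancel₀ hc.ne', one_smul]
  exact inf_eq_zero_of_le (posPart_nonneg _) le_rfl
    (smul_nonneg hc.le (posPart_nonneg _)) h (posPart_inf_negPart_eq_zero _)

end LatticeGroup

/-! ### Riesz–Kantorovich formulas and pointwise convergence criteria -/

section Dual

variable {E : Type*} [NormedAddCommGroup E] [NormedSpace ℝ E] [Lattice E] [HasSolidNorm E]
  [IsOrderedAddMonoid E]

theorem dual_apply_nonneg {f : StrongDual ℝ E} (hf : 0 ≤ f) {x : E} (hx : 0 ≤ x) : 0 ≤ f x :=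
  hf x hx

theorem dual_apply_mono {f : StrongDual ℝ E} (hf : 0 ≤ f) {x y : E} (hxy : x ≤ y) :
    f x ≤ f y := by
  have h := dual_apply_nonneg hf (sub_nonneg.2 hxy)
  rw [map_sub] at h
  linarith

theorem abs_apply_le_of_abs_le {f g : StrongDual ℝ E} (h : |f| ≤ g) (x : E) :
    |f x| ≤ g |x| := by
  have h1 : f ≤ g := (le_abs_self f).trans h
  have h2 : -f ≤ g := (neg_le_abs f).trans h
  have a1 := h1 _ (posPart_nonneg x)
  have a2 := h1 _ (negPart_nonneg x)
  have b1 := h2 _ (posPart_nonneg x)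
  have b2 := h2 _ (negPart_nonneg x)
  rw [neg_apply] at b1 b2
  have hx : f x = f x⁺ - f x⁻ := by rw [← map_sub, posPart_sub_negPart]
  have hg : g |x| = g x⁺ + g x⁻ := by rw [← map_add, posPart_add_negPart]
  rw [hx, hg, abs_le]
  constructor <;> linarith

theorem abs_apply_le (f : StrongDual ℝ E) (x : E) : |f x| ≤ |f| |x| :=
  abs_apply_le_of_abs_le le_rfl x

theorem exists_lt_rkSup (f : StrongDual ℝ E) {x : E} (hx : 0 ≤ x) {c : ℝ} (hc : c < rkSup f x) :
    ∃ y ∈ Set.Icc 0 x, c < f y := by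
  by_contra! h
  exact absurd (rkSup_le f hx h) (not_le.2 hc)

theorem dual_inf_apply (f g : StrongDual ℝ E) {x : E} (hx : 0 ≤ x) :
    (f ⊓ g) x = f x - rkSup (f - g) x := by
  change (f - dualPosPart (f - g)) x = _
  rw [sub_apply, dualPosPart_apply _ hx]

theorem dual_abs_apply (f : StrongDual ℝ E) {x : E} (hx : 0 ≤ x) :
    |f| x = rkSup (f - -f) x - f x := by
  change (-f + dualPosPart (f - -f)) x = _
  rw [add_apply, dualPosPart_apply _ hx, neg_apply]
  ring

/-- The Riesz–Kantorovich formula for the infimum of two disjoint functionals. -/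
theorem exists_split_of_inf_eq_zero {f g : StrongDual ℝ E} (h : f ⊓ g = 0) {x : E} (hx : 0 ≤ x)
    {δ : ℝ} (hδ : 0 < δ) : ∃ y ∈ Set.Icc 0 x, f (x - y) + g y < δ := by
  have h1 := dual_inf_apply f g hx
  rw [h, zero_apply] at h1
  obtain ⟨y, hy, hlt⟩ := exists_lt_rkSup (f - g) hx (c := f x - δ) (by linarith)
  refine ⟨y, hy, ?_⟩
  rw [sub_apply] at hlt
  rw [map_sub]
  linarith

theorem inf_eq_zero_of_exists_split {f g : StrongDual ℝ E} (hf : 0 ≤ f) (hg : 0 ≤ g)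
    (h : ∀ x : E, 0 ≤ x → ∀ δ > 0, ∃ y ∈ Set.Icc 0 x, f (x - y) + g y ≤ δ) : f ⊓ g = 0 := by
  refine le_antisymm (fun x hx => ?_) (le_inf hf hg)
  rw [dual_inf_apply f g hx, zero_apply]
  refine le_of_forall_pos_le_add fun δ hδ => ?_
  obtain ⟨y, hy, hle⟩ := h x hx δ hδ
  have h1 := le_rkSup (f - g) hy
  rw [sub_apply] at h1
  rw [map_sub] at hle
  linarith

/-- The Riesz–Kantorovich formula for the modulus of a functional. -/
theorem exists_abs_le_lt_apply (f : StrongDual ℝ E) {x : E} (hx : 0 ≤ x) {c : ℝ}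
    (hc : c < |f| x) : ∃ y : E, |y| ≤ x ∧ c < f y := by
  rw [dual_abs_apply f hx] at hc
  obtain ⟨z, hz, hlt⟩ := exists_lt_rkSup (f - -f) hx (c := c + f x) (by linarith)
  -- The map `z ↦ 2z - x` carries `[0, x]` into `[-x, x]`.
  refine ⟨z + z - x, ?_, ?_⟩
  · refine abs_le'.2 ⟨?_, ?_⟩
    · rw [sub_le_iff_le_add]
      exact add_le_add hz.2 hz.2
    · rw [neg_sub, sub_le_self_iff]
      exact add_nonneg hz.1 hz.1
  · rw [sub_apply, neg_apply] at hlt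
    rw [map_sub, map_add]
    linarith

theorem dual_abs_apply_le_norm (f : StrongDual ℝ E) {x : E} (hx : 0 ≤ x) :
    |f| x ≤ ‖f‖ * ‖x‖ := by
  by_contra! h
  obtain ⟨y, hy, hlt⟩ := exists_abs_le_lt_apply f hx h
  have h1 : ‖y‖ ≤ ‖x‖ := norm_le_norm_of_abs_le_abs (by rwa [abs_of_nonneg hx])
  have h2 := (le_abs_self _).trans (f.le_opNorm y)
  exact absurd (h2.trans (mul_le_mul_of_nonneg_left h1 (norm_nonneg f))) (not_le.2 hlt)

theorem weaklyNull_iff {X : Type*} [NormedAddCommGroup X] [NormedSpace ℝ X] {x : ℕ → X} :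
    WeaklyNull x ↔ ∀ f : StrongDual ℝ X, Tendsto (fun n => f (x n)) atTop (𝓝 0) := by
  refine (WeakBilin.tendsto_iff_forall_eval_tendsto (topDualPairing ℝ X).flip ?_).trans ?_
  · intro a b hab
    exact (SeparatingDual.eq_iff_forall_dual_eq (R := ℝ)).2 fun g => LinearMap.congr_fun hab g
  · refine forall_congr' fun f => ?_
    have h : ((topDualPairing ℝ X).flip 0) f = 0 := map_zero f
    exact Iff.of_eq (congrArg (fun r => Tendsto (fun n => f (x n)) atTop (𝓝 r)) h)

theorem weakStarNull_iff {X : Type*} [NormedAddCommGroup X] [NormedSpace ℝ X]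
    {f : ℕ → StrongDual ℝ X} :
    WeakStarNull f ↔ ∀ x, Tendsto (fun n => f n x) atTop (𝓝 0) :=
  tendsto_iff_forall_eval_tendsto_topDualPairing

theorem uniformlyNullOn_iff {X : Type*} [NormedAddCommGroup X] [NormedSpace ℝ X]
    {f : ℕ → StrongDual ℝ X} {A : Set X} :
    UniformlyNullOn f A ↔ ∀ ε > 0, ∀ᶠ n in atTop, ∀ x ∈ A, |f n x| < ε := by
  simp [UniformlyNullOn, Metric.tendstoUniformlyOn_iff]

theorem weaklyNull_of_forall_nonneg {x : ℕ → E}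
    (h : ∀ g : StrongDual ℝ E, 0 ≤ g → Tendsto (fun n => g |x n|) atTop (𝓝 0)) :
    WeaklyNull x := by
  refine weaklyNull_iff.2 fun f => squeeze_zero_norm (fun n => ?_) (h |f| (abs_nonneg f))
  exact abs_apply_le f (x n)

end Dual

/-! ### Disjointification -/

section Disjointification

variable {E : Type*} [NormedAddCommGroup E] [NormedSpace ℝ E] [CompleteSpace E]
    [Lattice E] [HasSolidNorm E] [IsOrderedAddMonoid E] [IsOrderedModule ℝ E]

/-- For `i < j` put `c = 4⁻ʲ`. At least `c • x j` is removed from `x i`, because `4⁻ʲ • x j ≤ 2⁻ⁱ •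
y`; at least `c⁻¹ • x i` is removed from `x j`, because `x i ≤ s j`. The two terms thus lie below a
disjoint pair. -/
theorem disjointSeq_posPart_sub {x : ℕ → E} (hx : ∀ n, 0 ≤ x n) {s : ℕ → E} (hs0 : ∀ n, 0 ≤ s n)
    (hs : ∀ i j, i < j → x i ≤ s j) {y : E} (hy : ∀ n, (1 / 2 : ℝ) ^ n • x n ≤ y) :
    DisjointSeq fun n => (x n - (4 : ℝ) ^ n • s n - (1 / 2 : ℝ) ^ n • y)⁺ := by
  have hy0 : 0 ≤ y := le_trans (by simpa using hx 0) (hy 0)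
  have key : ∀ i j, i < j → (x i - (4 : ℝ) ^ i • s i - (1 / 2 : ℝ) ^ i • y)⁺ ⊓
      (x j - (4 : ℝ) ^ j • s j - (1 / 2 : ℝ) ^ j • y)⁺ = 0 := by
    intro i j hij
    have hc : (0 : ℝ) < ((4 : ℝ) ^ j)⁻¹ := by positivity
    refine inf_eq_zero_of_le (posPart_nonneg _) (posPart_mono ?_) (posPart_nonneg _)
      (posPart_mono ?_) (posPart_sub_smul_inf_posPart_sub_smul (x i) (x j) hc)
    · rw [sub_sub]
      refine sub_le_sub_left ?_ _
      refine le_add_of_nonneg_of_le (smul_nonneg (by positivity) (hs0 i)) ?_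
      calc ((4 : ℝ) ^ j)⁻¹ • x j ≤ ((1 / 2 : ℝ) ^ i * (1 / 2 : ℝ) ^ j) • x j := by
            refine smul_le_smul_of_nonneg_right ?_ (hx j)
            have h4 : ((4 : ℝ) ^ j)⁻¹ = (1 / 2 : ℝ) ^ j * (1 / 2 : ℝ) ^ j := by
              rw [← mul_pow, ← inv_pow]; norm_num
            rw [h4]
            exact mul_le_mul_of_nonneg_right
              (pow_le_pow_of_le_one (by norm_num) (by norm_num) hij.le) (by positivity)
        _ = (1 / 2 : ℝ) ^ i • (1 / 2 : ℝ) ^ j • x j := (smul_smul _ _ _).symm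
        _ ≤ _ := smul_le_smul_of_nonneg_left (hy j) (by positivity)
    · rw [sub_sub, inv_inv]
      refine sub_le_sub_left ?_ _
      exact le_add_of_le_of_nonneg (smul_le_smul_of_nonneg_left (hs i j hij) (by positivity))
        (smul_nonneg (by positivity) hy0)
  intro i j hij
  rw [abs_of_nonneg (posPart_nonneg _), abs_of_nonneg (posPart_nonneg _)]
  rcases hij.lt_or_gt with h | h
  · exact key i j h
  · rw [inf_comm]
    exact key j i h

/-- Disjointification: if functionals in `B` tend to zero uniformly along the positive disjoint
sequences in the solid hull of `A`, then `A` is almost order bounded with respect to `B`. -/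
theorem exists_forall_apply_posPart_sub_le {A : Set E} (hA : Bornology.IsBounded A)
    {B : Set (StrongDual ℝ E)} (hB0 : ∀ f ∈ B, 0 ≤ f)
    (hBb : ∀ y : E, 0 ≤ y → ∃ C, ∀ f ∈ B, f y ≤ C)
    (hdis : ∀ v : ℕ → E, (∀ n, 0 ≤ v n) → DisjointSeq v →
      (∀ n, v n ∈ LatticeOrderedAddCommGroup.solidClosure A) →
      ∀ ε > 0, ∀ᶠ n in atTop, ∀ f ∈ B, f (v n) ≤ ε) {ε : ℝ} (hε : 0 < ε) :
    ∃ u : E, 0 ≤ u ∧ ∀ f ∈ B, ∀ x ∈ A, f (|x| - u)⁺ ≤ ε := by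
  by_contra! hcon
  choose! F hF X hX hFX using hcon
  obtain ⟨C, hC⟩ := hA.exists_norm_le
  -- Recursive choice: `s n` is the sum of `|x k|` over `k < n`, and `x n` is a counterexample in
  -- `A` to the bound `u = 4ⁿ • s n`.
  let s : ℕ → E := fun n => Nat.rec 0 (fun k t => t + |X ((4 : ℝ) ^ k • t)|) n
  let x : ℕ → E := fun n => X ((4 : ℝ) ^ n • s n)
  have hsucc : ∀ n, s (n + 1) = s n + |x n| := fun n => rfl
  have hs0 : ∀ n, 0 ≤ s n := by
    intro n
    induction n with
    | zero => exact le_rfl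
    | succ n ih => rw [hsucc]; exact add_nonneg ih (abs_nonneg _)
  have hsm : Monotone s := monotone_nat_of_le_succ fun n => by
    rw [hsucc]; exact le_add_of_nonneg_right (abs_nonneg _)
  have hs : ∀ i j, i < j → |x i| ≤ s j := fun i j hij =>
    le_trans (by rw [hsucc]; exact le_add_of_nonneg_left (hs0 i)) (hsm (Nat.succ_le_of_lt hij))
  have hu0 : ∀ n, 0 ≤ (4 : ℝ) ^ n • s n := fun n => smul_nonneg (by positivity) (hs0 n)
  have hxA : ∀ n, x n ∈ A := fun n => hX _ (hu0 n)
  have hsum : Summable fun n => (1 / 2 : ℝ) ^ n • |x n| := by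
    refine Summable.of_norm_bounded (summable_geometric_two.mul_right C) fun n => ?_
    rw [norm_smul, norm_abs_eq_norm, Real.norm_of_nonneg (by positivity)]
    exact mul_le_mul_of_nonneg_left (hC _ (hxA n)) (by positivity)
  set y : E := ∑' n, (1 / 2 : ℝ) ^ n • |x n| with hydef
  have hy : ∀ n, (1 / 2 : ℝ) ^ n • |x n| ≤ y := fun n =>
    hsum.le_tsum n fun k _ => smul_nonneg (by positivity) (abs_nonneg _)
  have hy0 : 0 ≤ y := tsum_nonneg fun k => smul_nonneg (by positivity) (abs_nonneg _)
  have hv := disjointSeq_posPart_sub (fun n => abs_nonneg (x n)) hs0 hs hy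
  obtain ⟨K, hK⟩ := hBb y hy0
  have hev := hdis _ (fun n => posPart_nonneg _) hv (fun n => ⟨x n, hxA n, by
    rw [abs_of_nonneg (posPart_nonneg _)]
    refine posPart_le_self_of_le (abs_nonneg _) ?_
    rw [sub_sub]
    exact sub_le_self _ (add_nonneg (hu0 n) (smul_nonneg (by positivity) hy0))⟩) (ε / 2)
    (half_pos hε)
  have hlim : Tendsto (fun n : ℕ => (1 / 2 : ℝ) ^ n * K) atTop (𝓝 0) := by
    simpa using (tendsto_pow_atTop_nhds_zero_of_lt_one (r := (1 / 2 : ℝ)) (by norm_num)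
      (by norm_num)).mul_const K
  obtain ⟨n, hn1, hn2⟩ := (hev.and (hlim.eventually_lt_const (half_pos hε))).exists
  have hfB := hF _ (hu0 n)
  have h1 := hn1 _ hfB
  have h2 := hFX _ (hu0 n)
  -- Removing `2⁻ⁿ • y`, which made the sequence disjoint, costs at most `2⁻ⁿ K < ε / 2`; the
  -- disjoint remainder contributes at most `ε / 2`.
  have h3 := dual_apply_mono (hB0 _ hfB)
    (posPart_le_posPart_sub_add (a := |x n| - (4 : ℝ) ^ n • s n) (b := (1 / 2 : ℝ) ^ n • y)
      (smul_nonneg (by positivity) hy0))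
  rw [map_add, map_smul, smul_eq_mul] at h3
  have h4 := mul_le_mul_of_nonneg_left (hK _ hfB) (by positivity : (0 : ℝ) ≤ (1 / 2) ^ n)
  linarith

end Disjointification

/-! ### Disjoint L-sequences tend to zero in modulus at each positive point -/

section LSequence

variable {E : Type*} [NormedAddCommGroup E] [NormedSpace ℝ E] [Lattice E] [HasSolidNorm E]
  [IsOrderedAddMonoid E]

/-- A large `|f k| (z n)` is witnessed by a large `f k (y n)` with `|y n| ≤ z n`; such `y` is again
weakly null by domination, so the L-property applies to it. -/
theorem IsLSequence.eventually_abs_apply_le {f : ℕ → StrongDual ℝ E} (hf : IsLSequence f)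
    {z : ℕ → E} (hz : ∀ n, 0 ≤ z n)
    (hzw : ∀ g : StrongDual ℝ E, 0 ≤ g → Tendsto (fun n => g (z n)) atTop (𝓝 0))
    {ε : ℝ} (hε : 0 < ε) : ∀ᶠ n in atTop, ∀ k, |f k| (z n) ≤ ε := by
  have hex : ∀ n, ∃ y : E, |y| ≤ z n ∧ ((∃ k, ε < |f k| (z n)) → ∃ k, ε < f k y) := by
    intro n
    by_cases h : ∃ k, ε < |f k| (z n)
    · obtain ⟨k, hk⟩ := h
      obtain ⟨y, hy, hlt⟩ := exists_abs_le_lt_apply (f k) (hz n) hk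
      exact ⟨y, hy, fun _ => ⟨k, hlt⟩⟩
    · exact ⟨0, by simpa using hz n, fun h' => absurd h' h⟩
  choose y hy hyk using hex
  have hyw : WeaklyNull y := weaklyNull_of_forall_nonneg fun g hg =>
    squeeze_zero (fun n => dual_apply_nonneg hg (abs_nonneg _))
      (fun n => dual_apply_mono hg (hy n)) (hzw g hg)
  have hev := Metric.tendstoUniformlyOn_iff.1 (hf.2 y hyw) ε hε
  filter_upwards [hev] with n hn
  by_contra! hcon
  obtain ⟨k, hk⟩ := hyk n hcon
  have h := hn (f k) ⟨k, rfl⟩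
  rw [dist_zero_left, Real.norm_eq_abs] at h
  linarith [le_abs_self (f k (y n))]

theorem IsLSequence.exists_abs_apply_le {f : ℕ → StrongDual ℝ E} (hf : IsLSequence f) {y : E}
    (hy : 0 ≤ y) : ∃ C, ∀ k, |f k| y ≤ C := by
  obtain ⟨C, hC⟩ := hf.1.exists_norm_le
  refine ⟨C * ‖y‖, fun k => (dual_abs_apply_le_norm (f k) hy).trans ?_⟩
  exact mul_le_mul_of_nonneg_right (hC _ ⟨k, rfl⟩) (norm_nonneg y)

/-- Order bounded monotone sequences are Cauchy, uniformly with respect to a family of positive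
functionals that tends to zero uniformly along positive weakly null sequences. -/
theorem exists_forall_apply_sub_le {F : ℕ → StrongDual ℝ E}
    (H : ∀ z : ℕ → E, (∀ n, 0 ≤ z n) →
      (∀ g : StrongDual ℝ E, 0 ≤ g → Tendsto (fun n => g (z n)) atTop (𝓝 0)) →
      ∀ ε > 0, ∀ᶠ n in atTop, ∀ k, F k (z n) ≤ ε)
    {w : ℕ → E} (hw : Monotone w) {u : E} (hu : ∀ n, w n ≤ u) {ε : ℝ} (hε : 0 < ε) :
    ∃ N, ∀ m ≥ N, ∀ k, F k (w m - w N) ≤ ε := by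
  by_contra! hcon
  choose m hm k hk using hcon
  have hmt : Tendsto m atTop atTop := tendsto_atTop_mono hm tendsto_id
  -- For each `g ≥ 0` the bounded monotone sequence `g (w n)` converges, so these increments are
  -- weakly null.
  have hz := H (fun n => w (m n) - w n) (fun n => sub_nonneg.2 (hw (hm n))) (fun g hg => by
    have hlim := tendsto_atTop_ciSup (f := fun n => g (w n))
      (fun a b hab => dual_apply_mono hg (hw hab))
      ⟨g u, by rintro _ ⟨n, rfl⟩; exact dual_apply_mono hg (hu n)⟩
    have h := (hlim.comp hmt).sub hlim
    rw [sub_self] at h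
    refine h.congr fun n => ?_
    rw [map_sub]
    rfl) ε hε
  obtain ⟨n, hn⟩ := hz.exists
  exact absurd (hn (k n)) (not_le.2 (hk n))

theorem sum_half_pow_mul_le (n : ℕ) {c : ℝ} (hc : 0 ≤ c) :
    ∑ i ∈ Finset.range n, (1 / 2 : ℝ) ^ i * c ≤ 2 * c := by
  rw [← Finset.sum_mul]
  exact mul_le_mul_of_nonneg_right (sum_geometric_two_le n) hc

/-- Disjointness gives `x n ∈ [0, u]` that almost exhausts `u` for `F n` and is almost null for all
earlier `F i`. The argument would like to use `sup_{j ≥ n} x j`, which need not exist; finite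
suprema replace it, with an error uniform in `k` by `exists_forall_apply_sub_le`. -/
theorem tendsto_apply_of_pairwise_disjoint {F : ℕ → StrongDual ℝ E} (hF : ∀ n, 0 ≤ F n)
    (hd : Pairwise fun m n => F m ⊓ F n = 0)
    (H : ∀ z : ℕ → E, (∀ n, 0 ≤ z n) →
      (∀ g : StrongDual ℝ E, 0 ≤ g → Tendsto (fun n => g (z n)) atTop (𝓝 0)) →
      ∀ ε > 0, ∀ᶠ n in atTop, ∀ k, F k (z n) ≤ ε)
    {u : E} (hu : 0 ≤ u) {ε : ℝ} (hε : 0 < ε) : ∀ᶠ n in atTop, F n u ≤ ε := by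
  -- The final estimate splits `F k u` into parts of size `δ`, `4δ` and `2δ`.
  obtain ⟨δ, hδ, hδε⟩ : ∃ δ : ℝ, 0 < δ ∧ 7 * δ = ε := ⟨ε / 7, by positivity, by ring⟩
  have hp : ∀ n : ℕ, 0 < (1 / 2 : ℝ) ^ n * δ := fun n => by positivity
  have hp1 : ∀ n : ℕ, (1 / 2 : ℝ) ^ n * δ ≤ δ := fun n =>
    mul_le_of_le_one_left hδ.le (pow_le_one₀ (by norm_num) (by norm_num))
  have hx : ∀ n, ∃ x ∈ Set.Icc 0 u, F n (u - x) ≤ (1 / 2 : ℝ) ^ n * δ ∧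
      ∀ i < n, F i x ≤ (1 / 2 : ℝ) ^ n * δ := by
    intro n
    obtain ⟨x, hx, hlt⟩ := exists_split_of_inf_eq_zero
      (inf_sum_eq_zero hF hd (s := Finset.range n) (n := n) (by simp)) hu (hp n)
    have hs : ∀ i < n, F i x ≤ (∑ i ∈ Finset.range n, F i) x := fun i hi =>
      Finset.single_le_sum (f := F) (fun j _ => hF j) (Finset.mem_range.2 hi) x hx.1
    have h0 : 0 ≤ (∑ i ∈ Finset.range n, F i) x :=
      dual_apply_nonneg (Finset.sum_nonneg fun j _ => hF j) hx.1
    have h1 := dual_apply_nonneg (hF n) (sub_nonneg.2 hx.2)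
    exact ⟨x, hx, by linarith, fun i hi => by linarith [hs i hi]⟩
  choose x hxu hxn hxi using hx
  have hwu : ∀ n m, partialSups (fun j => x (n + j)) m ≤ u := fun n m =>
    partialSups_le _ _ _ fun i _ => (hxu _).2
  have hm : ∀ n, ∃ N, ∀ m ≥ N, ∀ k, F k (partialSups (fun j => x (n + j)) m -
      partialSups (fun j => x (n + j)) N) ≤ (1 / 2 : ℝ) ^ n * δ := fun n =>
    exists_forall_apply_sub_le H (partialSups (fun j => x (n + j))).monotone (hwu n) (hp n)
  choose m hm using hm
  -- `y n` stands in for `sup_{j ≥ n} x j`: small for `F i` with `i < n`, and almost all of `u` for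
  -- `F j` with `j ≥ n`.
  set y : ℕ → E := fun n => partialSups (fun j => x (n + j)) (m n) with hy
  have hy0 : ∀ n, 0 ≤ y n := fun n =>
    (hxu (n + 0)).1.trans (le_partialSups_of_le (fun j => x (n + j)) (Nat.zero_le (m n)))
  have hyu : ∀ n, y n ≤ u := fun n => hwu n (m n)
  have hyi : ∀ n, ∀ i < n, F i (y n) ≤ 2 * δ := by
    intro n i hi
    refine (dual_apply_mono (hF i)
      (partialSups_le_sum (fun j => (hxu (n + j)).1) (m n))).trans ?_
    rw [map_sum]
    refine (Finset.sum_le_sum fun j _ => ?_).trans (sum_half_pow_mul_le (m n + 1) hδ.le)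
    refine (hxi (n + j) i (hi.trans_le (Nat.le_add_right n j))).trans ?_
    exact mul_le_mul_of_nonneg_right
      (pow_le_pow_of_le_one (by norm_num) (by norm_num) (Nat.le_add_left j n)) hδ.le
  have hyj : ∀ n, ∀ j ≥ n, F j (u - y n) ≤ (1 / 2 : ℝ) ^ n * (2 * δ) := by
    intro n j hj
    obtain ⟨p, rfl⟩ := Nat.exists_eq_add_of_le hj
    have h1 := hm n (max p (m n)) (le_max_right _ _) (n + p)
    have h2 : F (n + p) (u - partialSups (fun j => x (n + j)) (max p (m n))) ≤
        (1 / 2 : ℝ) ^ (n + p) * δ :=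
      (dual_apply_mono (hF _) (sub_le_sub_left
        (le_partialSups_of_le (fun j => x (n + j)) (le_max_left p (m n))) u)).trans (hxn (n + p))
    have h3 : (1 / 2 : ℝ) ^ (n + p) * δ ≤ (1 / 2 : ℝ) ^ n * δ := mul_le_mul_of_nonneg_right
      (pow_le_pow_of_le_one (by norm_num) (by norm_num) (Nat.le_add_right n p)) hδ.le
    rw [map_sub] at h1 h2 ⊢
    linarith
  set T := partialSups fun k => u - y k with hT
  obtain ⟨N, hN⟩ := exists_forall_apply_sub_le H T.monotone (u := u)
    (fun n => partialSups_le _ _ _ fun k _ => sub_le_self _ (hy0 k)) hδ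
  filter_upwards [eventually_ge_atTop N] with k hk
  -- The index is `k + 1` because `y n` is small only for `F i` with `i < n` strictly.
  have h1 := hN (k + 1) (by omega) k
  have h2 : F k (T N) ≤ 2 * (2 * δ) := by
    refine (dual_apply_mono (hF k)
      (partialSups_le_sum (fun j => sub_nonneg.2 (hyu j)) N)).trans ?_
    rw [map_sum]
    refine (Finset.sum_le_sum fun j hj => ?_).trans
      (sum_half_pow_mul_le (N + 1) (by positivity : 0 ≤ 2 * δ))
    exact hyj j k (by have := Finset.mem_range.1 hj; omega)
  have h3 : F k (u - T (k + 1)) ≤ 2 * δ := by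
    refine (dual_apply_mono (hF k) ?_).trans (hyi (k + 1) k (Nat.lt_succ_self k))
    rw [sub_le_comm]
    exact le_partialSups (fun k => u - y k) (k + 1)
  rw [map_sub] at h1 h3
  linarith

end LSequence

/-! ### Consequences of disjoint weak compactness -/

section Consequences

variable {E : Type*} [NormedAddCommGroup E] [NormedSpace ℝ E] [CompleteSpace E]
    [Lattice E] [HasSolidNorm E] [IsOrderedAddMonoid E] [IsOrderedModule ℝ E]

theorem abs_apply_le_add_of_posPart_sub {f F : StrongDual ℝ E} (h : |f| ≤ F) (x u : E) :
    |f x| ≤ F (|x| - u)⁺ + F u := by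
  refine (abs_apply_le_of_abs_le h x).trans ?_
  rw [← map_add]
  refine dual_apply_mono ((abs_nonneg f).trans h) ?_
  rw [← sub_le_iff_le_add]
  exact le_posPart _

theorem IsDisjointlyWeaklyCompact.uniformlyNullOn_of_weakStarNull {A : Set E}
    (hA : IsDisjointlyWeaklyCompact A) {f : ℕ → StrongDual ℝ E} (hf0 : ∀ n, 0 ≤ f n)
    (hfb : OrderBoundedSeq f) (hf : WeakStarNull f) : UniformlyNullOn f A := by
  obtain ⟨a, g, hab⟩ := hfb
  have hg : 0 ≤ g := (hf0 0).trans (hab 0).2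
  refine uniformlyNullOn_iff.2 fun ε hε => ?_
  obtain ⟨u, hu, hle⟩ := exists_forall_apply_posPart_sub_le hA.1 (B := {g})
    (by rintro _ rfl; exact hg) (fun y _ => ⟨g y, by rintro _ rfl; exact le_rfl⟩)
    (fun v _ hv hvA δ hδ => by
      filter_upwards [(weaklyNull_iff.1 (hA.2 v hv hvA) g).eventually_lt_const hδ] with n hn
      rintro _ rfl
      exact hn.le) (half_pos hε)
  filter_upwards [(weakStarNull_iff.1 hf u).eventually_lt_const (half_pos hε)] with n hn x hx
  have h1 := abs_apply_le_add_of_posPart_sub (abs_of_nonneg (hf0 n)).le x u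
  have h2 := (hab n).2 _ (posPart_nonneg (|x| - u))
  linarith [hle g rfl x hx]

theorem IsDisjointlyWeaklyCompact.uniformlyNullOn_of_isLSequence {A : Set E}
    (hA : IsDisjointlyWeaklyCompact A) {f : ℕ → StrongDual ℝ E} (hfd : DisjointSeq f)
    (hf : IsLSequence f) : UniformlyNullOn f A := by
  refine uniformlyNullOn_iff.2 fun ε hε => ?_
  obtain ⟨u, hu, hle⟩ := exists_forall_apply_posPart_sub_le hA.1
    (B := Set.range fun n => |f n|) (by rintro _ ⟨n, rfl⟩; exact abs_nonneg _)
    (fun y hy => by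
      obtain ⟨C, hC⟩ := hf.exists_abs_apply_le hy
      exact ⟨C, by rintro _ ⟨n, rfl⟩; exact hC n⟩)
    (fun v hv0 hv hvA δ hδ => by
      filter_upwards [hf.eventually_abs_apply_le hv0
        (fun g _ => weaklyNull_iff.1 (hA.2 v hv hvA) g) hδ] with n hn
      rintro _ ⟨k, rfl⟩
      exact hn k) (half_pos hε)
  -- Both estimates are non-strict; `ε / 2 + ε / 3` leaves the room for a strict inequality.
  filter_upwards [tendsto_apply_of_pairwise_disjoint (fun n => abs_nonneg (f n)) hfd
    (fun z hz hzw δ hδ => hf.eventually_abs_apply_le hz hzw hδ) hu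
    (by positivity : 0 < ε / 3)] with n hn x hx
  have h1 := abs_apply_le_add_of_posPart_sub (le_refl |f n|) x u
  linarith [hle _ ⟨n, rfl⟩ x hx]

end Consequences

/-! ### Components of functionals, and the return to disjoint weak compactness -/

section Component

theorem nsmul_inf_eq_zero {G : Type*} [AddCommGroup G] [Lattice G] [IsOrderedAddMonoid G]
    {a b : G} (ha : 0 ≤ a) (hb : 0 ≤ b) (h : a ⊓ b = 0) (k : ℕ) : (k • a) ⊓ b = 0 := by
  induction k with
  | zero => simpa using hb
  | succ k ih =>
    rw [inf_comm] at ih h ⊢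
    refine le_antisymm ?_ (le_inf hb (nsmul_nonneg ha _))
    rw [succ_nsmul]
    refine (inf_add_le_inf_add_inf (nsmul_nonneg ha k) ha hb).trans ?_
    rw [ih, h, add_zero]

variable {E : Type*} [NormedAddCommGroup E] [NormedSpace ℝ E] [Lattice E] [HasSolidNorm E]
  [IsOrderedAddMonoid E]

/-- A function that is additive on the positive cone and dominated there by a continuous functional
extends to a positive continuous functional. -/
theorem exists_dual_of_additive {φ : E → ℝ}
    (hadd : ∀ x y : E, 0 ≤ x → 0 ≤ y → φ (x + y) = φ x + φ y) (h0 : ∀ x : E, 0 ≤ x → 0 ≤ φ x)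
    {g : StrongDual ℝ E} (hg : ∀ x : E, 0 ≤ x → φ x ≤ g x) :
    ∃ p : StrongDual ℝ E, 0 ≤ p ∧ p ≤ g ∧ ∀ x : E, 0 ≤ x → p x = φ x := by
  let ψ : E →+ ℝ := AddMonoidHom.mk' (fun x => φ x⁺ - φ x⁻) fun x y => by
    have h1 : (x + y)⁺ + (x⁻ + y⁻) = (x⁺ + y⁺) + (x + y)⁻ := by
      rw [← sub_eq_sub_iff_add_eq_add, add_sub_add_comm, posPart_sub_negPart,
        posPart_sub_negPart, posPart_sub_negPart]
    have h2 := congrArg φ h1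
    rw [hadd _ _ (posPart_nonneg _) (add_nonneg (negPart_nonneg _) (negPart_nonneg _)),
      hadd _ _ (negPart_nonneg _) (negPart_nonneg _),
      hadd _ _ (add_nonneg (posPart_nonneg _) (posPart_nonneg _)) (negPart_nonneg _),
      hadd _ _ (posPart_nonneg _) (posPart_nonneg _)] at h2
    linarith
  have hb : ∀ x, ‖ψ x‖ ≤ ‖g‖ * ‖x‖ := by
    intro x
    have h1 : |ψ x| ≤ g |x| := by
      rw [← posPart_add_negPart x, map_add]
      change |φ x⁺ - φ x⁻| ≤ _
      have a1 := h0 _ (posPart_nonneg x)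
      have a2 := h0 _ (negPart_nonneg x)
      have b1 := hg _ (posPart_nonneg x)
      have b2 := hg _ (negPart_nonneg x)
      rw [abs_le]
      constructor <;> linarith
    have h2 := (le_abs_self _).trans (g.le_opNorm |x|)
    rw [norm_abs_eq_norm] at h2
    exact h1.trans h2
  have hφ0 : φ 0 = 0 := by simpa using hadd 0 0 le_rfl le_rfl
  have hψ : ∀ x : E, 0 ≤ x → ψ x = φ x := by
    intro x hx
    change φ x⁺ - φ x⁻ = φ x
    rw [posPart_of_nonneg hx, negPart_of_nonneg hx, hφ0, sub_zero]
  refine ⟨ψ.toRealLinearMap (AddMonoidHomClass.continuous_of_bound ψ ‖g‖ hb),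
    fun x hx => ?_, fun x hx => ?_, hψ⟩
  · change (0 : ℝ) ≤ ψ x
    rw [hψ x hx]
    exact h0 x hx
  · change ψ x ≤ g x
    rw [hψ x hx]
    exact hg x hx

/-- The component of a positive functional `g` carried by the principal band of `w`. -/
theorem exists_component {g : StrongDual ℝ E} (hg : 0 ≤ g) {w : E} (hw : 0 ≤ w) :
    ∃ p : StrongDual ℝ E, 0 ≤ p ∧ p ≤ g ∧ p w = g w ∧ (∀ x : E, 0 ≤ x → w ⊓ x = 0 → p x = 0) ∧
      ∀ x : E, 0 ≤ x → ∀ δ > 0, ∃ k : ℕ, p (x - x ⊓ k • w) ≤ δ := by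
  have hkw : ∀ k : ℕ, 0 ≤ k • w := fun k => nsmul_nonneg hw k
  have hmono : Monotone fun k : ℕ => k • w := fun a b hab => nsmul_le_nsmul_left hw hab
  -- This is `g` composed with the band projection `x ↦ sup_k (x ⊓ k • w)`, with the supremum taken
  -- in `ℝ` since it may not exist in `E`.
  let φ : E → ℝ := fun x => ⨆ k : ℕ, g (x ⊓ k • w)
  have hbdd : ∀ x : E, BddAbove (Set.range fun k : ℕ => g (x ⊓ k • w)) := fun x =>
    ⟨g x, by rintro _ ⟨k, rfl⟩; exact dual_apply_mono hg inf_le_left⟩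
  have hle : ∀ (x : E) (k : ℕ), g (x ⊓ k • w) ≤ φ x := fun x k => le_ciSup (hbdd x) k
  have hφg : ∀ x : E, φ x ≤ g x := fun x => ciSup_le fun k => dual_apply_mono hg inf_le_left
  have hadd : ∀ x y : E, 0 ≤ x → 0 ≤ y → φ (x + y) = φ x + φ y := by
    intro x y hx hy
    apply le_antisymm
    · refine ciSup_le fun k => ?_
      have h := dual_apply_mono hg (inf_add_le_inf_add_inf hx hy (hkw k))
      rw [map_add, inf_comm _ (x + y), inf_comm _ x, inf_comm _ y] at h
      linarith [hle x k, hle y k]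
    -- Superadditivity: `x ⊓ k • w + y ⊓ l • w ≤ (x + y) ⊓ (k + l) • w`.
    · have hkl : ∀ k l : ℕ, g (x ⊓ k • w) + g (y ⊓ l • w) ≤ φ (x + y) := by
        intro k l
        refine le_trans ?_ (hle (x + y) (k + l))
        rw [← map_add, add_nsmul]
        exact dual_apply_mono hg (le_inf (add_le_add inf_le_left inf_le_left)
          (add_le_add inf_le_right inf_le_right))
      have h1 : ∀ l : ℕ, φ x ≤ φ (x + y) - g (y ⊓ l • w) := fun l =>
        ciSup_le fun k => by linarith [hkl k l]
      have h2 : φ y ≤ φ (x + y) - φ x := ciSup_le fun l => by linarith [h1 l]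
      linarith
  obtain ⟨p, hp0, hpg, hp⟩ := exists_dual_of_additive hadd
    (fun x hx => (dual_apply_nonneg hg (le_inf hx (hkw 0))).trans (hle x 0)) (fun x _ => hφg x)
  refine ⟨p, hp0, hpg, ?_, fun x hx hwx => ?_, fun x hx δ hδ => ?_⟩
  · refine le_antisymm (hpg w hw) ?_
    rw [hp w hw]
    simpa using hle w 1
  · refine le_antisymm ?_ (dual_apply_nonneg hp0 hx)
    rw [hp x hx]
    refine ciSup_le fun k => ?_
    rw [inf_comm, nsmul_inf_eq_zero hw hx hwx k, map_zero]
  · obtain ⟨k, hk⟩ := exists_lt_of_lt_ciSup (show φ x - δ < ⨆ k : ℕ, g (x ⊓ k • w) from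
      sub_lt_self _ hδ)
    refine ⟨k, ?_⟩
    have h1 := hle (x ⊓ k • w) k
    rw [inf_assoc, inf_idem, ← hp _ (le_inf hx (hkw k))] at h1
    rw [← hp x hx] at hk
    rw [map_sub]
    linarith

/-- Take the components of `g` on the bands of the `|x n|`. On `y ≥ 0`, `p m` lives up to `δ` on `y
⊓ k • |x m|`, which is disjoint from `|x n|` and so annihilated by `p n`; this is the splitting that
proves disjointness. -/
theorem exists_disjoint_components {g : StrongDual ℝ E} (hg : 0 ≤ g) {x : ℕ → E}
    (hx : DisjointSeq x) : ∃ p : ℕ → StrongDual ℝ E, (∀ n, 0 ≤ p n) ∧ (∀ n, p n ≤ g) ∧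
      (Pairwise fun m n => p m ⊓ p n = 0) ∧ ∀ n, p n |x n| = g |x n| := by
  choose p hp0 hpg hpw hpd hpk using fun n => exists_component hg (abs_nonneg (x n))
  refine ⟨p, hp0, hpg, fun m n hmn => ?_, hpw⟩
  refine inf_eq_zero_of_exists_split (hp0 m) (hp0 n) fun y hy δ hδ => ?_
  obtain ⟨k, hk⟩ := hpk m y hy δ hδ
  have hkw : 0 ≤ k • |x m| := nsmul_nonneg (abs_nonneg _) k
  refine ⟨y ⊓ k • |x m|, ⟨le_inf hy hkw, inf_le_left⟩, ?_⟩
  rw [hpd n _ (le_inf hy hkw), add_zero]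
  · exact hk
  · refine inf_eq_zero_of_le (abs_nonneg _) le_rfl (le_inf hy hkw) inf_le_right ?_
    rw [inf_comm]
    exact nsmul_inf_eq_zero (abs_nonneg _) (abs_nonneg _) (hx hmn) k

theorem disjointSeq_of_le {G : Type*} [AddCommGroup G] [Lattice G] [IsOrderedAddMonoid G]
    {p q : ℕ → G} (hq0 : ∀ n, 0 ≤ q n) (hqp : ∀ n, q n ≤ p n)
    (hp : Pairwise fun m n => p m ⊓ p n = 0) : DisjointSeq q := by
  intro m n hmn
  rw [abs_of_nonneg (hq0 m), abs_of_nonneg (hq0 n)]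
  exact inf_eq_zero_of_le (hq0 m) (hqp m) (hq0 n) (hqp n) (hp hmn)

/-- With `|x n| ≤ |a n|` and `a n ∈ A`, the hypothesis controls values at `a n`, not at `|a n|`.
Cutting `p n` further into components `q n`, `r n` on `(a n)⁺`, `(a n)⁻` repairs this: `g |x n| = p
n |x n| ≤ p n |a n| = q n (a n) - r n (a n)`. -/
theorem isDisjointlyWeaklyCompact_of_uniformlyNullOn {A : Set E} (hA : Bornology.IsBounded A)
    (h : ∀ f : ℕ → StrongDual ℝ E, DisjointSeq f → OrderBoundedSeq f → UniformlyNullOn f A) :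
    IsDisjointlyWeaklyCompact A := by
  refine ⟨hA, fun x hx hxA => weaklyNull_of_forall_nonneg fun g hg => ?_⟩
  choose a haA hxa using hxA
  obtain ⟨p, hp0, hpg, hpd, hpx⟩ := exists_disjoint_components hg hx
  have key : ∀ w : ℕ → E, (∀ n, 0 ≤ w n) → ∃ q : ℕ → StrongDual ℝ E,
      (∀ n, q n (w n) = p n (w n)) ∧ (∀ n, ∀ y : E, 0 ≤ y → w n ⊓ y = 0 → q n y = 0) ∧
      Tendsto (fun n => q n (a n)) atTop (𝓝 0) := by
    intro w hw
    choose q hq0 hqp hqw hqd _ using fun n => exists_component (hp0 n) (hw n)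
    refine ⟨q, hqw, hqd, ?_⟩
    have hu := uniformlyNullOn_iff.1
      (h q (disjointSeq_of_le hq0 hqp hpd) ⟨0, g, fun n => ⟨hq0 n, (hqp n).trans (hpg n)⟩⟩)
    refine Metric.tendsto_atTop'.2 fun ε hε => ?_
    obtain ⟨N, hN⟩ := eventually_atTop.1 (hu ε hε)
    exact ⟨N, fun n hn => by
      rw [dist_zero_right, Real.norm_eq_abs]
      exact hN n hn.le _ (haA n)⟩
  obtain ⟨q, hqw, hqd, hq⟩ := key (fun n => (a n)⁺) fun n => posPart_nonneg _
  obtain ⟨r, hrw, hrd, hr⟩ := key (fun n => (a n)⁻) fun n => negPart_nonneg _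
  have hqr := hq.sub hr
  rw [sub_zero] at hqr
  refine squeeze_zero (fun n => dual_apply_nonneg hg (abs_nonneg _)) (fun n => ?_) hqr
  have h1 : q n (a n) = p n (a n)⁺ := by
    rw [← hqw n]
    nth_rw 1 [← posPart_sub_negPart (a n)]
    rw [map_sub, hqd n _ (negPart_nonneg _) (posPart_inf_negPart_eq_zero _), sub_zero]
  have h2 : r n (a n) = -p n (a n)⁻ := by
    rw [← hrw n]
    nth_rw 1 [← posPart_sub_negPart (a n)]
    rw [map_sub, hrd n _ (posPart_nonneg _)
      (by rw [inf_comm]; exact posPart_inf_negPart_eq_zero _), zero_sub]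
  have h3 := dual_apply_mono (hp0 n) (hxa n)
  rw [← posPart_add_negPart (a n), map_add, hpx n] at h3
  rw [h1, h2]
  linarith

end Component

/-! ### Order bounded disjoint sequences of functionals -/

section OrderBounded

variable {E : Type*} [NormedAddCommGroup E] [NormedSpace ℝ E] [Lattice E] [HasSolidNorm E]
  [IsOrderedAddMonoid E]

theorem OrderBoundedSeq.exists_abs_le {G : Type*} [AddCommGroup G] [Lattice G]
    [IsOrderedAddMonoid G] {f : ℕ → G} (hf : OrderBoundedSeq f) : ∃ g : G, ∀ n, |f n| ≤ g := by
  obtain ⟨a, b, hab⟩ := hf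
  refine ⟨-a ⊔ b, fun n => abs_le'.2 ⟨(hab n).2.trans le_sup_right, ?_⟩⟩
  exact (neg_le_neg (hab n).1).trans le_sup_left

variable {f : ℕ → StrongDual ℝ E} {g : StrongDual ℝ E}

theorem sum_abs_apply_le (hd : DisjointSeq f) (hg : ∀ n, |f n| ≤ g) {x : E} (hx : 0 ≤ x)
    (s : Finset ℕ) : ∑ i ∈ s, |f i| x ≤ g x := by
  have h := sum_le_of_pairwise_inf_eq_zero (fun n => abs_nonneg (f n)) hd hg s x hx
  rwa [sum_apply] at h

theorem summable_abs_apply (hd : DisjointSeq f) (hg : ∀ n, |f n| ≤ g) {x : E} (hx : 0 ≤ x) :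
    Summable fun n => |f n| x :=
  summable_of_sum_le (fun n => dual_apply_nonneg (abs_nonneg (f n)) hx)
    (sum_abs_apply_le hd hg hx)

theorem weakStarNull_of_abs_le_abs (hd : DisjointSeq f) (hg : ∀ n, |f n| ≤ g)
    {q : ℕ → StrongDual ℝ E} (hq : ∀ n, |q n| ≤ |f n|) : WeakStarNull q := by
  refine weakStarNull_iff.2 fun x => squeeze_zero_norm (fun n => ?_)
    (summable_abs_apply hd hg (abs_nonneg x)).tendsto_atTop_zero
  exact abs_apply_le_of_abs_le (hq n) x

theorem uniformlyNullOn_of_disjointSeq {A : Set E}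
    (h : ∀ f : ℕ → StrongDual ℝ E, (∀ n, 0 ≤ f n) → OrderBoundedSeq f → WeakStarNull f →
      UniformlyNullOn f A) (hd : DisjointSeq f) (hf : OrderBoundedSeq f) :
    UniformlyNullOn f A := by
  obtain ⟨g, hg⟩ := hf.exists_abs_le
  have key : ∀ q : ℕ → StrongDual ℝ E, (∀ n, 0 ≤ q n) → (∀ n, q n ≤ |f n|) →
      UniformlyNullOn q A := fun q hq0 hqf =>
    h q hq0 ⟨0, g, fun n => ⟨hq0 n, (hqf n).trans (hg n)⟩⟩
      (weakStarNull_of_abs_le_abs hd hg fun n => by rw [abs_of_nonneg (hq0 n)]; exact hqf n)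
  have h1 := uniformlyNullOn_iff.1
    (key (fun n => (f n)⁺) (fun n => posPart_nonneg _) fun n => posPart_le_abs' _)
  have h2 := uniformlyNullOn_iff.1
    (key (fun n => (f n)⁻) (fun n => negPart_nonneg _) fun n => negPart_le_abs' _)
  refine uniformlyNullOn_iff.2 fun ε hε => ?_
  filter_upwards [h1 _ (half_pos hε), h2 _ (half_pos hε)] with n hn1 hn2 x hx
  have hx1 := abs_lt.1 (hn1 x hx)
  have hx2 := abs_lt.1 (hn2 x hx)
  have hfx : f n x = (f n)⁺ x - (f n)⁻ x := by rw [← sub_apply, posPart_sub_negPart]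
  rw [hfx, abs_lt]
  constructor <;> linarith [hx1.1, hx1.2, hx2.1, hx2.2]

/-- The sum of `f n x` over the `n` selected by `S`. -/
noncomputable def selectedSum (f : ℕ → StrongDual ℝ E) (S : ℕ → Bool) (x : E) : ℝ :=
  ∑' n, if S n then f n x else 0

theorem norm_selected_le (f : ℕ → StrongDual ℝ E) (S : ℕ → Bool) (x : E) (n : ℕ) :
    ‖if S n then f n x else 0‖ ≤ |f n| |x| := by
  split_ifs
  · exact abs_apply_le (f n) x
  · rw [norm_zero]
    exact dual_apply_nonneg (abs_nonneg (f n)) (abs_nonneg x)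

theorem summable_selected (hd : DisjointSeq f) (hg : ∀ n, |f n| ≤ g) (S : ℕ → Bool) (x : E) :
    Summable fun n => if S n then f n x else 0 :=
  Summable.of_norm_bounded (summable_abs_apply hd hg (abs_nonneg x)) (norm_selected_le f S x)

/-- Weierstrass test: each term depends on one coordinate of `S`, and the bounds `|f n| |x|` are
summable and independent of `S`. -/
theorem continuous_selectedSum (hd : DisjointSeq f) (hg : ∀ n, |f n| ≤ g) (x : E) :
    Continuous fun S => selectedSum f S x :=
  continuous_tsum
    (fun n => (continuous_of_discreteTopology (f := fun b : Bool => if b then f n x else 0)).comp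
      (continuous_apply n))
    (summable_abs_apply hd hg (abs_nonneg x)) fun n S => norm_selected_le f S x n

theorem exists_dual_eq_selectedSum (hd : DisjointSeq f) (hg : ∀ n, |f n| ≤ g) (S : ℕ → Bool) :
    ∃ h : StrongDual ℝ E, ∀ x, h x = selectedSum f S x := by
  let L : E →ₗ[ℝ] ℝ :=
    { toFun := selectedSum f S
      map_add' := fun x y => by
        rw [selectedSum, selectedSum, selectedSum,
          ← (summable_selected hd hg S x).tsum_add (summable_selected hd hg S y)]
        refine tsum_congr fun n => ?_
        split_ifs <;> simp
      map_smul' := fun c x => by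
        rw [RingHom.id_apply, smul_eq_mul, selectedSum, selectedSum, ← tsum_mul_left]
        refine tsum_congr fun n => ?_
        split_ifs <;> simp }
  refine ⟨L.mkContinuous ‖g‖ fun x => ?_, fun x => rfl⟩
  have h1 : ‖selectedSum f S x‖ ≤ ∑' n, |f n| |x| :=
    tsum_of_norm_bounded (summable_abs_apply hd hg (abs_nonneg x)).hasSum
      (norm_selected_le f S x)
  have h2 : ∑' n, |f n| |x| ≤ g |x| :=
    (summable_abs_apply hd hg (abs_nonneg x)).tsum_le_of_sum_le
      (sum_abs_apply_le hd hg (abs_nonneg x))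
  have h3 := (le_abs_self _).trans (g.le_opNorm |x|)
  rw [norm_abs_eq_norm] at h3
  exact h1.trans (h2.trans h3)

theorem selectedSum_update_sub (hd : DisjointSeq f) (hg : ∀ n, |f n| ≤ g) (S : ℕ → Bool) (n : ℕ)
    (x : E) : selectedSum f (Function.update S n true) x -
      selectedSum f (Function.update S n false) x = f n x := by
  rw [selectedSum, selectedSum,
    ← (summable_selected hd hg _ x).tsum_sub (summable_selected hd hg _ x), tsum_eq_single n]
  · simp
  · intro m hm
    simp [Function.update_of_ne hm]

theorem tendsto_update_atTop (S : ℕ → Bool) (b : Bool) :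
    Tendsto (fun n => Function.update S n b) atTop (𝓝 S) := by
  refine tendsto_pi_nhds.2 fun i => tendsto_const_nhds.congr' ?_
  filter_upwards [eventually_gt_atTop i] with n hn
  rw [Function.update_of_ne hn.ne]

/-- Order bounded disjoint sequences of functionals are L-sequences; the uniformity comes from the
Baire category theorem on the Cantor space of all selections. -/
theorem isLSequence_of_disjointSeq (hd : DisjointSeq f) (hf : OrderBoundedSeq f) :
    IsLSequence f := by
  obtain ⟨g, hg⟩ := hf.exists_abs_le
  have hg0 : 0 ≤ g := (abs_nonneg _).trans (hg 0)
  refine ⟨isBounded_iff_forall_norm_le.2 ⟨‖g‖, ?_⟩, fun x hx => ?_⟩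
  · rintro _ ⟨n, rfl⟩
    refine ContinuousLinearMap.opNorm_le_bound _ (norm_nonneg g) fun x => ?_
    have h := (le_abs_self _).trans (g.le_opNorm |x|)
    rw [norm_abs_eq_norm] at h
    exact (abs_apply_le_of_abs_le (hg n) x).trans h
  rw [weaklyNull_iff] at hx
  refine Metric.tendstoUniformlyOn_iff.2 fun ε hε => ?_
  -- These closed sets cover the Cantor space, since each selected sum is a continuous functional
  -- and `x` is weakly null.
  let C : ℕ → Set (ℕ → Bool) := fun K => {S | ∀ k ≥ K, |selectedSum f S (x k)| ≤ ε / 3}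
  have hC : ∀ K, IsClosed (C K) := fun K => by
    have : C K = ⋂ k ≥ K, {S | |selectedSum f S (x k)| ≤ ε / 3} := by
      ext S
      simp [C]
    rw [this]
    exact isClosed_biInter fun k _ =>
      isClosed_le (continuous_selectedSum hd hg (x k)).abs continuous_const
  have hU : ⋃ K, C K = Set.univ := by
    refine Set.eq_univ_of_forall fun S => ?_
    obtain ⟨h, hh⟩ := exists_dual_eq_selectedSum hd hg S
    have hlim := (hx h).abs
    rw [abs_zero] at hlim
    obtain ⟨K, hK⟩ := eventually_atTop.1
      (hlim.eventually_lt_const (by positivity : 0 < ε / 3))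
    exact Set.mem_iUnion.2 ⟨K, fun k hk => by rw [← hh]; exact (hK k hk).le⟩
  obtain ⟨K, S, hS⟩ := nonempty_interior_of_iUnion_of_closed hC hU
  -- Changing a far coordinate `n` of the interior point `S` stays in `C K`, and `f n (x k)` is the
  -- difference of the two resulting sums: at most `2ε / 3` for all `n ≥ N` and `k ≥ K`. The
  -- finitely many `n < N` are treated one by one.
  have hev := fun b => (tendsto_update_atTop S b).eventually (mem_interior_iff_mem_nhds.1 hS)
  obtain ⟨N, hN⟩ := eventually_atTop.1 ((hev true).and (hev false))
  have hfin : ∀ᶠ k in atTop, ∀ n ∈ Set.Iio N, |f n (x k)| < ε :=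
    (eventually_all_finite (Set.finite_Iio N)).2 fun n _ => by
      have hlim := (hx (f n)).abs
      rw [abs_zero] at hlim
      exact hlim.eventually_lt_const hε
  filter_upwards [hfin, eventually_ge_atTop K] with k hk1 hk2
  rintro _ ⟨n, rfl⟩
  rw [dist_zero_left, Real.norm_eq_abs]
  rcases lt_or_ge n N with hn | hn
  · exact hk1 n hn
  · have h1 := (hN n hn).1 k hk2
    have h2 := (hN n hn).2 k hk2
    rw [← selectedSum_update_sub hd hg S n (x k)]
    refine (abs_sub _ _).trans_lt ?_
    linarith

end OrderBounded

end BanachLattice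

/-! ### The equivalence -/

theorem theorem2p3 {E : Type*} [NormedAddCommGroup E] [NormedSpace ℝ E] [CompleteSpace E]
    [Lattice E] [HasSolidNorm E] [IsOrderedAddMonoid E] [IsOrderedModule ℝ E]
    (A : Set E) (hA : Bornology.IsBounded A) :
    [ IsDisjointlyWeaklyCompact A,
      ∀ f : ℕ → StrongDual ℝ E, (∀ n, 0 ≤ f n) → OrderBoundedSeq f → WeakStarNull f →
        UniformlyNullOn f A,
      ∀ f : ℕ → StrongDual ℝ E, DisjointSeq f → IsLSequence f → UniformlyNullOn f A,
      ∀ f : ℕ → StrongDual ℝ E, DisjointSeq f → OrderBoundedSeq f → UniformlyNullOn f A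
    ].TFAE := by
  tfae_have 1 → 2 := fun h _ hf0 hfb hf => h.uniformlyNullOn_of_weakStarNull hf0 hfb hf
  tfae_have 1 → 3 := fun h _ hfd hf => h.uniformlyNullOn_of_isLSequence hfd hf
  tfae_have 2 → 4 := fun h _ hfd hf => uniformlyNullOn_of_disjointSeq h hfd hf
  tfae_have 3 → 4 := fun h f hfd hf => h f hfd (isLSequence_of_disjointSeq hfd hf)
  tfae_have 4 → 1 := isDisjointlyWeaklyCompact_of_uniformlyNullOn hA
  tfae_finish
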